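/- Let $G$ be a finite simple graph. Let $\tau(G)$ be the number of spanning trees of $G$, let $L(G)=\Delta(G)-A(G)$ be its Laplacian matrix and $Q(G)=\Delta(G)+A(G)=XX^{\top}$ its signless Laplacian matrix, where $A(G)$ is the adjacency matrix, $\Delta(G)$ the diagonal matrix of vertex degrees and $X$ the $0,1$ vertex-edge incidence matrix of $G$. Let $\mathcal{L}(G)$ be the line graph of $G$. Eigenvalues and their multiplicities are those of real symmetric matrices. (a) If $G$ is connected and $L(G)$ or $Q(G)$ has an even integer eigenvalue of multiplicity at least $2$, then $4$ divides $\tau(G)$. (b) If the adjacency matrix $A(\mathcal{L}(G))$ of the line graph has an even integer eigenvalue $\lambda\neq-2$ of multiplicity at least $2$, then $4$ divides $\tau(G)$. -/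

import Mathlib

namespace SimpleGraph

/-- The signless Laplacian `Q(G) = X Xᵀ`, where `X` is the 0-1 vertex-edge incidence matrix of `G`.
In `incMatrix` the columns are indexed by all unordered pairs of vertices; those of the
non-edges vanish, so they do not contribute to the product. -/
def signlessLapMatrix {V : Type*} (R : Type*) [NonAssocSemiring R] [Fintype V] [DecidableEq V]
    (G : SimpleGraph V) [DecidableRel G.Adj] : Matrix V V R :=
  G.incMatrix R * (G.incMatrix R).transpose

/-- `Q(G)` is the sum of the degree matrix and the adjacency matrix. -/
theorem signlessLapMatrix_eq {V : Type*} (R : Type*) [Semiring R] [Fintype V]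
    [DecidableEq V] (G : SimpleGraph V) [DecidableRel G.Adj] :
    G.signlessLapMatrix R = G.degMatrix R + G.adjMatrix R := by
  ext a b
  rw [signlessLapMatrix, Matrix.add_apply, degMatrix, adjMatrix_apply]
  by_cases hab : a = b
  · subst hab
    rw [incMatrix_mul_transpose_diag]
    simp
  · rw [Matrix.diagonal_apply_ne _ hab, zero_add]
    split_ifs with h
    · exact G.incMatrix_mul_transpose_apply_of_adj h
    · rw [Matrix.mul_apply]
      refine Finset.sum_eq_zero fun e _ => ?_
      rw [Matrix.transpose_apply]
      exact G.incMatrix_apply_mul_incMatrix_apply_of_not_adj (R := R) hab h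

/-- `τ(G)`, the number of spanning trees of `G`: the trees on the whole vertex set of `G`
all of whose edges are edges of `G`. -/
noncomputable def spanningTreeCount {V : Type*} (G : SimpleGraph V) : ℕ :=
  Set.ncard {T : SimpleGraph V | T ≤ G ∧ T.IsTree}

end SimpleGraph

/-- The multiplicity of `μ` as an eigenvalue of `M`, that is, the dimension of its eigenspace
(`0` when `μ` is not an eigenvalue). -/
noncomputable def eigenvalueMultiplicity {n : Type*} [Fintype n] [DecidableEq n]
    (M : Matrix n n ℝ) (μ : ℝ) : ℕ :=
  Module.finrank ℝ (Module.End.eigenspace (Matrix.toLin' M) μ)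

/-!
The determinant of the Laplacian `L` with the row of a vertex `r` replaced by the unit vector `e_r`
is `τ(G)`: this is the matrix-tree theorem, `SimpleGraph.det_updateRow_lapMatrix`. Expanding this
determinant linearly in each row gives one term for each function `f` that fixes `r` and sends every
other vertex to a neighbour. The term is `1` if all iterates of `f` lead to `r`, because the matrix
is then `1 - N` with `N` nilpotent, and `0` otherwise, because the indicator of the vertices that
never reach `r` is in the kernel. The functions of the first kind are the parent functions of the
spanning trees rooted at `r`.

An integer eigenvalue `k` of multiplicity at least `2` has an integer eigenvector `z` with an odd
entry and with `z r = 0`. For even `k`, both `L z = k z` and `Q z = k z` take the form `L z = 2 D z`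
with an integer diagonal matrix `D`. Since the entries of `L z` sum to zero, so do those of `D z`,
hence `zᵀ D z ≡ 1ᵀ D z = 0` modulo `2`. Let `M` be `L` with its row `r` replaced by `e_r`. Then
`M z = 2 w` and `zᵀ M = (L z)ᵀ` is even, where `w = D z`. Cramer's rule gives
`det M * z i = 2 * det M'`, with `M'` obtained from `M` by putting `w` in column `i`; and `det M'` is
even, because `z` annihilates `M'` from the left modulo `2`: its product with the new column is
`zᵀ D z`. Choosing `z i` odd shows that `4` divides `det M = τ(G)`; see
`Int.four_dvd_det_of_mulVec_eq_two_smul` and `Int.four_dvd_det_updateRow_single`.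

For the line graph, `A + 2 = Xᵀ X`, so that `X` embeds the eigenspace of `A` for `λ ≠ -2` into the
eigenspace of `Q = X Xᵀ` for `λ + 2`. If `G` is not connected, then `τ(G) = 0`.
-/

/-! ### Integer matrices with a kernel modulo two -/

open Matrix in
theorem Int.dvd_det_mul_of_vecMul_eq_smul {n : Type*} [Fintype n] [DecidableEq n]
    {M : Matrix n n ℤ} {z t : n → ℤ} {c : ℤ} (h : z ᵥ* M = c • t) (j : n) :
    c ∣ M.det * z j := by
  refine ⟨(t ᵥ* M.adjugate) j, ?_⟩
  have h1 : (z ᵥ* M) ᵥ* M.adjugate = c • (t ᵥ* M.adjugate) := by rw [h, smul_vecMul]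
  rw [vecMul_vecMul, mul_adjugate] at h1
  have h2 := congrFun h1 j
  rw [mul_comm]
  simpa [vecMul_smul] using h2

open Matrix in
/-- If `M` kills a nonzero vector `z` modulo `2` from both sides, say `M z = 2 w`, and `z ⬝ᵥ w` is
even, then `4 ∣ det M`: Cramer's rule gives `det M * z i = 2 * det (M.updateCol i w)`, and `z` also
kills `M.updateCol i w` from the left modulo `2`. -/
theorem Int.four_dvd_det_of_mulVec_eq_two_smul {n : Type*} [Fintype n] [DecidableEq n]
    {M : Matrix n n ℤ} {z w t : n → ℤ} (hM : M *ᵥ z = (2 : ℤ) • w) (hM' : z ᵥ* M = (2 : ℤ) • t)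
    (hzw : Even (z ⬝ᵥ w)) (hz : ∃ i, Odd (z i)) : 4 ∣ M.det := by
  obtain ⟨i, hi⟩ := hz
  have h1 : M.det * z i = 2 * (M.updateCol i w).det := by
    have h2 : M.adjugate *ᵥ (M *ᵥ z) = (2 : ℤ) • (M.adjugate *ᵥ w) := by rw [hM, mulVec_smul]
    rw [mulVec_mulVec, adjugate_mul, ← cramer_eq_adjugate_mulVec] at h2
    have h3 := congrFun h2 i
    simpa [smul_mulVec, cramer_apply] using h3
  obtain ⟨s, hs⟩ := hzw
  have h4 : z ᵥ* M.updateCol i w = (2 : ℤ) • Function.update t i s := by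
    ext j
    by_cases hj : j = i
    · subst hj
      simp [vecMul, updateCol_self, dotProduct, Function.update_self] at hs ⊢
      linarith
    · have h5 := congrFun hM' j
      simpa [vecMul, dotProduct, updateCol_ne hj, Function.update_of_ne hj] using h5
  have h6 : (2 : ℤ) ∣ (M.updateCol i w).det :=
    (Int.isCoprime_two_left.2 hi).dvd_of_dvd_mul_right
      (Int.dvd_det_mul_of_vecMul_eq_smul h4 i)
  have h7 : (4 : ℤ) ∣ M.det * z i := by
    rw [h1]
    exact mul_dvd_mul_left 2 h6
  have h8 : IsCoprime (4 : ℤ) (z i) := by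
    simpa using (Int.isCoprime_two_left.2 hi).pow_left (m := 2)
  exact h8.dvd_of_dvd_mul_right h7

open Matrix in
/-- The Gram determinant `det (Bᵀ * B)` carries solvability of `B x = 0` from `ℝ` down to `ℤ`, and
an integer solution divided by the gcd of its entries has an odd entry. -/
theorem Int.exists_odd_mulVec_eq_zero {m n : Type*} [Fintype m] [Fintype n]
    [DecidableEq n] {B : Matrix m n ℤ} {x : n → ℝ} (hx : x ≠ 0)
    (hB : B.map (Int.cast : ℤ → ℝ) *ᵥ x = 0) :
    ∃ z : n → ℤ, B *ᵥ z = 0 ∧ ∃ i, Odd (z i) := by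
  have hdet : (Bᵀ * B).det = 0 := by
    have h1 : ((Bᵀ * B).map (Int.cast : ℤ → ℝ)).det = 0 := by
      refine exists_mulVec_eq_zero_iff.1 ⟨x, hx, ?_⟩
      have h2 : (Bᵀ * B).map (Int.cast : ℤ → ℝ)
          = Bᵀ.map (Int.cast : ℤ → ℝ) * B.map (Int.cast : ℤ → ℝ) :=
        Matrix.map_mul (f := Int.castRingHom ℝ)
      rw [h2, ← mulVec_mulVec, hB, mulVec_zero]
    have h3 := (Int.castRingHom ℝ).map_det (Bᵀ * B)
    have h4 : ((Bᵀ * B).det : ℝ) = 0 := h3.trans h1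
    exact_mod_cast h4
  obtain ⟨y, hy, hy0⟩ := exists_mulVec_eq_zero_iff.2 hdet
  have hBy : B *ᵥ y = 0 := by
    have h5 : (B *ᵥ y) ⬝ᵥ (B *ᵥ y) = 0 := by
      rw [dotProduct_mulVec, vecMul_mulVec, ← dotProduct_comm, ← mulVec_transpose,
        transpose_mul, transpose_transpose, hy0, dotProduct_zero]
    exact dotProduct_self_eq_zero.1 h5
  obtain ⟨i, hi⟩ := Function.ne_iff.1 hy
  obtain ⟨z, hz, hgcd⟩ := Finset.extract_gcd y ⟨i, Finset.mem_univ i⟩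
  have hg : Finset.univ.gcd y ≠ 0 := fun h => hi (Finset.gcd_eq_zero_iff.1 h i (Finset.mem_univ i))
  have hyz : y = Finset.univ.gcd y • z := funext fun j => hz j (Finset.mem_univ j)
  refine ⟨z, ?_, ?_⟩
  · rw [hyz, mulVec_smul] at hBy
    exact (smul_eq_zero.1 hBy).resolve_left hg
  · by_contra! h
    have h6 : (2 : ℤ) ∣ Finset.univ.gcd z :=
      Finset.dvd_gcd fun j _ => (Int.not_odd_iff_even.1 (h j)).two_dvd
    rw [hgcd] at h6
    norm_num at h6

open Matrix in
/-- The root coordinate can be made to vanish because the eigenspace has dimension at least `2`;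
together with an odd entry this makes the vector differ from `0` and from `1` modulo `2`. -/
theorem exists_odd_mulVec_eq_smul_of_two_le_eigenvalueMultiplicity {n : Type*} [Fintype n]
    [DecidableEq n] {A : Matrix n n ℤ} {k : ℤ}
    (h : 2 ≤ eigenvalueMultiplicity (A.map (Int.cast : ℤ → ℝ)) (k : ℝ)) (r : n) :
    ∃ z : n → ℤ, A *ᵥ z = k • z ∧ z r = 0 ∧ ∃ i, Odd (z i) := by
  set E := Module.End.eigenspace (Matrix.toLin' (A.map (Int.cast : ℤ → ℝ))) (k : ℝ) with hE
  have hker : LinearMap.ker ((LinearMap.proj r : (n → ℝ) →ₗ[ℝ] ℝ) ∘ₗ E.subtype) ≠ ⊥ := by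
    apply LinearMap.ker_ne_bot_of_finrank_lt
    rw [Module.finrank_self]
    exact h
  obtain ⟨⟨x, hxE⟩, hxr, hx0⟩ := Submodule.exists_mem_ne_zero_of_ne_bot hker
  have hxr' : x r = 0 := by simpa using hxr
  have hx0' : x ≠ 0 := fun h0 => hx0 (Subtype.ext h0)
  have hxE' : A.map (Int.cast : ℤ → ℝ) *ᵥ x = (k : ℝ) • x := by
    simpa [hE, Module.End.mem_eigenspace_iff, toLin'_apply] using hxE
  let B : Matrix (n ⊕ Unit) n ℤ := fromRows (A - diagonal fun _ => k) (of fun _ => Pi.single r 1)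
  have hB : B.map (Int.cast : ℤ → ℝ) *ᵥ x = 0 := by
    ext (i | i)
    · have h1 := congrFun hxE' i
      simp only [mulVec, dotProduct, map_apply, Pi.smul_apply, smul_eq_mul] at h1
      simp [B, mulVec, dotProduct, sub_mul, h1, diagonal_apply, Finset.sum_sub_distrib,
        apply_ite (Int.cast : ℤ → ℝ)]
    · simp [B, mulVec, dotProduct, Pi.single_apply, hxr']
  obtain ⟨z, hz, hodd⟩ := Int.exists_odd_mulVec_eq_zero hx0' hB
  rw [fromRows_mulVec] at hz
  refine ⟨z, ?_, ?_, hodd⟩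
  · ext i
    have h1 := congrFun hz (Sum.inl i)
    simp only [Sum.elim_inl, sub_mulVec, Pi.sub_apply, mulVec_diagonal] at h1
    exact sub_eq_zero.1 h1
  · have h1 := congrFun hz (Sum.inr ())
    simpa [mulVec] using h1

open Matrix in
theorem Int.four_dvd_det_updateRow_single {n : Type*} [Fintype n] [DecidableEq n]
    {L : Matrix n n ℤ} (hL : L.IsSymm) (hL1 : L *ᵥ 1 = 0) {z d : n → ℤ}
    (hz : L *ᵥ z = (2 : ℤ) • (d * z)) {r : n} (hzr : z r = 0) (hodd : ∃ i, Odd (z i)) :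
    4 ∣ (L.updateRow r (Pi.single r 1)).det := by
  -- As `z r = 0`, the product of the new row `e_r` with `z` is `0`, and changing the row `r` does
  -- not affect `z ᵥ* L`.
  refine Int.four_dvd_det_of_mulVec_eq_two_smul (z := z) (w := d * z) (t := d * z) ?_ ?_ ?_ hodd
  · ext i
    by_cases hi : i = r
    · subst hi
      simp [mulVec, hzr]
    · have h1 := congrFun hz i
      simpa [mulVec, updateRow_ne hi] using h1
  · rw [← hz, ← hL.eq, mulVec_transpose, hL.eq]
    ext j
    refine Finset.sum_congr rfl fun i _ => ?_
    by_cases hi : i = r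
    · subst hi
      simp [hzr]
    · simp [updateRow_ne hi]
  · -- `∑ d z² ≡ ∑ d z`, and `2 ∑ d z` is the sum of the entries of `L z`, which is zero.
    have h1 : (1 : n → ℤ) ⬝ᵥ (L *ᵥ z) = 0 := by
      rw [dotProduct_mulVec, ← mulVec_transpose, hL.eq, hL1, zero_dotProduct]
    have h2 : ∑ i, d i * z i = 0 := by
      rw [hz, dotProduct_smul] at h1
      simpa [dotProduct] using h1
    have h3 : z ⬝ᵥ (d * z) = ∑ i, d i * (z i * (z i - 1)) := by
      rw [← sub_zero (z ⬝ᵥ (d * z)), ← h2, dotProduct, ← Finset.sum_sub_distrib]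
      exact Finset.sum_congr rfl fun i _ => by simp only [Pi.mul_apply]; ring
    rw [h3, even_iff_two_dvd]
    exact Finset.dvd_sum fun i _ => (Int.even_mul_pred_self (z i)).two_dvd.mul_left _

/-! ### Spanning trees and parent functions -/

namespace SimpleGraph

variable {V : Type*}

/-- The graph of a parent function `f`: every vertex `v` is joined to `f v`; fixed points of `f`
(the root) contribute no edge. -/
def parentGraph (f : V → V) : SimpleGraph V :=
  fromRel fun u v => f u = v

theorem parentGraph_adj {f : V → V} {u v : V} :
    (parentGraph f).Adj u v ↔ u ≠ v ∧ (f u = v ∨ f v = u) :=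
  fromRel_adj _ u v

/-- `IsParentFun G r f`: `f` sends each vertex other than the root `r` to a neighbour in `G`, fixes
`r`, and iterating `f` leads from every vertex to `r`. -/
structure IsParentFun (G : SimpleGraph V) (r : V) (f : V → V) : Prop where
  map_root : f r = r
  adj : ∀ v, v ≠ r → G.Adj v (f v)
  reaches : ∀ v, ∃ k, f^[k] v = r

namespace IsParentFun

variable {G : SimpleGraph V} {r : V} {f g : V → V}

/-- Induction along the iterates of a parent function, from the root outwards. -/
theorem induction (hf : IsParentFun G r f) {P : V → Prop} (root : P r)
    (step : ∀ v, v ≠ r → P (f v) → P v) (v : V) : P v := by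
  obtain ⟨k, hk⟩ := hf.reaches v
  induction k generalizing v with
  | zero => exact (show v = r from hk) ▸ root
  | succ k ih =>
    by_cases hv : v = r
    · exact hv ▸ root
    · exact step v hv (ih (f v) hk)

theorem parentGraph_adj_map (hf : IsParentFun G r f) {v : V} (hv : v ≠ r) :
    (parentGraph f).Adj v (f v) :=
  parentGraph_adj.2 ⟨(hf.adj v hv).ne, .inl rfl⟩

theorem map_map_ne (hf : IsParentFun G r f) {v : V} (hv : v ≠ r) : f (f v) ≠ v := by
  intro h
  obtain ⟨k, hk⟩ := hf.reaches v
  have h2 : ∀ k, f^[k] v ≠ r ∧ f^[k + 1] v ≠ r := by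
    intro k
    induction k with
    | zero =>
      refine ⟨hv, fun h3 => hv ?_⟩
      rw [← h, show f v = r from h3, hf.map_root]
    | succ k ih =>
      refine ⟨ih.2, ?_⟩
      rw [Function.iterate_succ_apply, Function.iterate_succ_apply, h]
      exact ih.1
  exact (h2 k).1 hk

theorem parentGraph_le (hf : IsParentFun G r f) : parentGraph f ≤ G := by
  have key : ∀ u v, u ≠ v → f u = v → G.Adj u v := by
    rintro u _ huv rfl
    refine hf.adj u fun h => huv ?_
    rw [h, hf.map_root]
  intro u v huv
  obtain ⟨hne, h | h⟩ := parentGraph_adj.1 huv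
  · exact key u v hne h
  · exact (key v u hne.symm h).symm

theorem connected_parentGraph (hf : IsParentFun G r f) : (parentGraph f).Connected := by
  have h : ∀ v, (parentGraph f).Reachable v r :=
    hf.induction .rfl fun v hv ih => (hf.parentGraph_adj_map hv).reachable.trans ih
  exact { preconnected := fun u v => (h u).trans (h v).symm, nonempty := ⟨r⟩ }

/-- The graph is connected and has at most one edge `s(v, f v)` for each vertex `v ≠ r`. -/
theorem isTree_parentGraph [Finite V] (hf : IsParentFun G r f) : (parentGraph f).IsTree := by
  have := Fintype.ofFinite V
  classical
  refine isTree_iff_connected_and_card.2 ⟨hf.connected_parentGraph, ?_⟩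
  refine le_antisymm ?_ hf.connected_parentGraph.card_vert_le_card_edgeSet_add_one
  have hsub : (parentGraph f).edgeFinset ⊆ (Finset.univ.erase r).image fun v => s(v, f v) := by
    intro e
    induction e with | _ u v
    rw [mem_edgeFinset, mem_edgeSet, parentGraph_adj, Finset.mem_image]
    rintro ⟨hne, h | h⟩
    · exact ⟨u, by grind [hf.map_root], by rw [h]⟩
    · exact ⟨v, by grind [hf.map_root], by rw [h, Sym2.eq_swap]⟩
  have h1 := (Finset.card_le_card hsub).trans Finset.card_image_le
  rw [Finset.card_erase_of_mem (Finset.mem_univ r), Finset.card_univ] at h1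
  have h2 : 0 < Fintype.card V := Fintype.card_pos_iff.2 ⟨r⟩
  rw [Nat.card_eq_fintype_card, Nat.card_eq_fintype_card, ← edgeFinset_card]
  omega

/-- A tree determines its parent function: outwards from the root, an edge `s(v, f v)` of the graph
of `g` must have `g v = f v`, as `g (f v) = v` would give `f (f v) = v`. -/
theorem eq_of_parentGraph_eq (hf : IsParentFun G r f) (hg : IsParentFun G r g)
    (h : parentGraph f = parentGraph g) : f = g := by
  funext v
  refine hf.induction (P := fun v => f v = g v) (by rw [hf.map_root, hg.map_root])
    (fun v hv ih => ?_) v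
  have h1 := hf.parentGraph_adj_map hv
  rw [h, parentGraph_adj] at h1
  obtain ⟨-, h2 | h2⟩ := h1
  · exact h2.symm
  · exact absurd (ih.trans h2) (hf.map_map_ne hv)

end IsParentFun

theorem Connected.exists_adj_dist_eq_add_one {T : SimpleGraph V} (hT : T.Connected) {v r : V}
    (hv : v ≠ r) : ∃ u, T.Adj v u ∧ T.dist v r = T.dist u r + 1 := by
  obtain ⟨p, hp⟩ := hT.exists_walk_length_eq_dist v r
  cases p with
  | nil => exact absurd rfl hv
  | cons h q =>
    rename_i u
    refine ⟨u, h, le_antisymm ?_ ?_⟩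
    · have := hT.dist_triangle (u := v) (v := u) (w := r)
      rw [dist_eq_one_iff_adj.2 h] at this
      omega
    · rw [← hp, Walk.length_cons]
      exact Nat.add_le_add_right (dist_le q) 1

/-- The parent of a vertex is a neighbour closer to the root; the tree contains the resulting
connected graph, and equals it by minimality. -/
theorem IsTree.exists_isParentFun {G T : SimpleGraph V} (hT : T.IsTree) (hle : T ≤ G) (r : V) :
    ∃ f, IsParentFun G r f ∧ parentGraph f = T := by
  classical
  have h : ∀ v, ∃ u, (v = r → u = r) ∧ (v ≠ r → T.Adj v u ∧ T.dist v r = T.dist u r + 1) := by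
    intro v
    by_cases hv : v = r
    · exact ⟨r, fun _ => rfl, fun h => absurd hv h⟩
    · obtain ⟨u, hu⟩ := hT.connected.exists_adj_dist_eq_add_one hv
      exact ⟨u, fun h => absurd h hv, fun _ => hu⟩
  choose f hfr hf using h
  have hreach : ∀ d v, T.dist v r = d → f^[d] v = r := by
    intro d
    induction d with
    | zero => exact fun v hv => hT.connected.dist_eq_zero_iff.1 hv
    | succ d ih =>
      intro v hv
      have hvr : v ≠ r := by rintro rfl; simp at hv
      exact ih (f v) (by have := (hf v hvr).2; omega)
  have hfT : IsParentFun T r f := ⟨hfr r rfl, fun v hv => (hf v hv).1, fun v => ⟨_, hreach _ v rfl⟩⟩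
  exact ⟨f, ⟨hfT.map_root, fun v hv => hle (hfT.adj v hv), hfT.reaches⟩, le_antisymm
    hfT.parentGraph_le
    ((isTree_iff_minimal_connected.1 hT).2 hfT.connected_parentGraph hfT.parentGraph_le)⟩

theorem spanningTreeCount_eq_ncard_isParentFun [Finite V] (G : SimpleGraph V) (r : V) :
    G.spanningTreeCount = Set.ncard {f | IsParentFun G r f} := by
  refine (Set.ncard_congr (fun f _ => parentGraph f) ?_ ?_ ?_).symm
  · exact fun f hf => ⟨hf.parentGraph_le, hf.isTree_parentGraph⟩
  · exact fun f g hf hg h => hf.eq_of_parentGraph_eq hg h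
  · rintro T ⟨hle, hT⟩
    obtain ⟨f, hf, h⟩ := hT.exists_isParentFun hle r
    exact ⟨f, hf, h⟩

end SimpleGraph

/-! ### The matrix-tree theorem -/

open Matrix in
theorem Matrix.det_one_sub_of_isNilpotent {n R : Type*} [Fintype n] [DecidableEq n] [CommRing R]
    [IsDomain R] {N : Matrix n n R} (hN : IsNilpotent N) : (1 - N).det = 1 := by
  have h1 := sub_eq_zero.1 (isNilpotent_charpoly_sub_pow_of_isNilpotent hN).eq_zero
  have h2 := eval_charpoly N 1
  rw [h1] at h2
  simpa using h2.symm

namespace SimpleGraph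

variable {V : Type*} [DecidableEq V]

/-- The matrix with rows `e_v - e_{f v}` for `v ≠ r` and row `e_r` at `r`: the Laplacian of the
functional digraph of `f`, with the row of the root replaced by a unit vector. -/
def parentMatrix (r : V) (f : V → V) : Matrix V V ℤ :=
  Matrix.of fun v => if v = r then Pi.single r 1 else Pi.single v 1 - Pi.single (f v) 1

variable [Fintype V]

open Matrix in
theorem parentMatrix_mulVec_apply (r : V) (f : V → V) (x : V → ℤ) (v : V) :
    (parentMatrix r f *ᵥ x) v = if v = r then x r else x v - x (f v) := by
  by_cases hv : v = r
  · simp [parentMatrix, mulVec, hv]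
  · have hrow : parentMatrix r f v = Pi.single v 1 - Pi.single (f v) 1 := if_neg hv
    rw [mulVec, hrow, sub_dotProduct, if_neg hv, single_one_dotProduct, single_one_dotProduct]

open Matrix in
/-- `1 - parentMatrix r f` is nilpotent, since it transports a vector along `f` and kills it on
reaching `r`. -/
theorem IsParentFun.det_parentMatrix {G : SimpleGraph V} {r : V} {f : V → V}
    (hf : IsParentFun G r f) : (parentMatrix r f).det = 1 := by
  set N := 1 - parentMatrix r f with hN
  have hNx : ∀ (x : V → ℤ) v, (N *ᵥ x) v = if v = r then 0 else x (f v) := by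
    intro x v
    rw [hN, sub_mulVec, one_mulVec, Pi.sub_apply, parentMatrix_mulVec_apply]
    split_ifs with h
    · rw [h, sub_self]
    · ring
  have hkill : ∀ k x v, f^[k] v = r → ((N ^ (k + 1)) *ᵥ x) v = 0 := by
    intro k
    induction k with
    | zero =>
      intro x v hv
      rw [zero_add, pow_one, hNx, if_pos (show v = r from hv)]
    | succ k ih =>
      intro x v hv
      rw [pow_succ' N (k + 1), ← mulVec_mulVec, hNx]
      split_ifs
      · rfl
      · exact ih x (f v) hv
  choose k hk using hf.reaches
  have hnil : IsNilpotent N := by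
    refine ⟨Finset.univ.sup k + 1, ?_⟩
    refine ext_of_mulVec_single fun i => funext fun v => ?_
    rw [hkill _ _ v, zero_mulVec, Pi.zero_apply]
    obtain ⟨m, hm⟩ := Nat.exists_eq_add_of_le' (Finset.le_sup (f := k) (Finset.mem_univ v))
    rw [hm, Function.iterate_add_apply, hk]
    exact Function.iterate_fixed hf.map_root m
  rw [← det_one_sub_of_isNilpotent hnil, hN, sub_sub_cancel]

open Matrix in
/-- The indicator of the vertices whose iterates avoid `r` lies in the kernel. -/
theorem det_parentMatrix_eq_zero {r : V} {f : V → V} (h : ∃ v, ∀ k, f^[k] v ≠ r) :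
    (parentMatrix r f).det = 0 := by
  classical
  obtain ⟨v, hv⟩ := h
  refine exists_mulVec_eq_zero_iff.1 ⟨fun u => if ∀ k, f^[k] u ≠ r then 1 else 0, ?_, ?_⟩
  · exact Function.ne_iff.2 ⟨v, by simp [hv]⟩
  · ext u
    rw [parentMatrix_mulVec_apply]
    split_ifs with h1 h2 h2 h3 h3
    · exact absurd rfl (h2 0)
    · rfl
    · rfl
    · exact absurd (fun k => h2 (k + 1)) h3
    · refine absurd (fun k => ?_) h2
      cases k with
      | zero => exact h1
      | succ k => exact h3 k
    · rfl

/-- The matrix-tree theorem, with the row of `r` replaced by a unit vector instead of deleting the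
row and column of `r`. -/
theorem det_updateRow_lapMatrix (G : SimpleGraph V) [DecidableRel G.Adj] (r : V) :
    ((G.lapMatrix ℤ).updateRow r (Pi.single r 1)).det = G.spanningTreeCount := by
  classical
  let A : V → Finset V := fun v => if v = r then {r} else G.neighborFinset v
  let row : V → V → V → ℤ := fun v u =>
    if v = r then Pi.single r 1 else Pi.single v 1 - Pi.single u 1
  have hrow : (G.lapMatrix ℤ).updateRow r (Pi.single r 1) = fun v => ∑ u ∈ A v, row v u := by
    funext v
    by_cases hv : v = r
    · subst hv
      simp [A, row]
    · simp only [Matrix.updateRow_ne hv, A, row, if_neg hv]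
      ext w
      simp [lapMatrix, degMatrix, Matrix.diagonal_apply, adjMatrix_apply, Finset.sum_apply,
        Pi.single_apply, eq_comm]
  have hexp : ((G.lapMatrix ℤ).updateRow r (Pi.single r 1)).det =
      ∑ f ∈ Fintype.piFinset A, (parentMatrix r f).det := by
    rw [hrow]
    exact (Matrix.detRowAlternating (R := ℤ) (n := V)).toMultilinearMap.map_sum_finset row A
  have hdet : ∀ f ∈ Fintype.piFinset A,
      (parentMatrix r f).det = if IsParentFun G r f then 1 else 0 := by
    intro f hf
    rw [Fintype.mem_piFinset] at hf
    have hfr : f r = r := by simpa [A] using hf r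
    have hadj : ∀ v, v ≠ r → G.Adj v (f v) := fun v hv => by simpa [A, hv] using hf v
    split_ifs with h
    · exact h.det_parentMatrix
    · refine det_parentMatrix_eq_zero ?_
      by_contra! h'
      exact h ⟨hfr, hadj, h'⟩
  rw [hexp, Finset.sum_congr rfl hdet, Finset.sum_boole,
    G.spanningTreeCount_eq_ncard_isParentFun r, ← Set.ncard_coe_finset]
  congr 2
  ext f
  simp only [Finset.coe_filter, Fintype.mem_piFinset, Set.mem_ofPred_eq, and_iff_right_iff_imp]
  intro hf v
  by_cases hv : v = r
  · subst hv
    simp [A, hf.map_root]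
  · simpa [A, hv] using hf.adj v hv

end SimpleGraph

/-! ### Eigenvalues of the Laplacians and of the line graph -/

namespace SimpleGraph

variable {V : Type*} [Fintype V] [DecidableEq V] (G : SimpleGraph V) [DecidableRel G.Adj]

theorem lapMatrix_map_intCast :
    (G.lapMatrix ℤ).map (Int.cast : ℤ → ℝ) = G.lapMatrix ℝ := by
  ext i j
  simp [lapMatrix, degMatrix, Matrix.diagonal_apply, adjMatrix_apply, apply_ite (Int.cast : ℤ → ℝ)]

theorem signlessLapMatrix_map_intCast :
    (G.signlessLapMatrix ℤ).map (Int.cast : ℤ → ℝ) = G.signlessLapMatrix ℝ := by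
  ext i j
  simp [signlessLapMatrix_eq, degMatrix, Matrix.diagonal_apply, adjMatrix_apply,
    apply_ite (Int.cast : ℤ → ℝ)]

open Matrix in
theorem signlessLapMatrix_mulVec_eq (z : V → ℤ) :
    G.signlessLapMatrix ℤ *ᵥ z = (2 : ℤ) • (G.degMatrix ℤ *ᵥ z) - G.lapMatrix ℤ *ᵥ z := by
  rw [signlessLapMatrix_eq, lapMatrix, add_mulVec, sub_mulVec, two_smul]
  abel

open Matrix in
/-- Both kinds of eigenvectors enter through this lemma: `L z = k z` is the case `d = k / 2`, and
`Q z = k z` is the case `d = deg - k / 2`. -/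
theorem four_dvd_spanningTreeCount_of_mulVec_eq {z d : V → ℤ}
    (hz : G.lapMatrix ℤ *ᵥ z = (2 : ℤ) • (d * z)) {r : V} (hzr : z r = 0)
    (hodd : ∃ i, Odd (z i)) : 4 ∣ G.spanningTreeCount := by
  have h := Int.four_dvd_det_updateRow_single (G.isSymm_lapMatrix ℤ)
    (G.lapMatrix_mulVec_const_eq_zero (R := ℤ)) hz hzr hodd
  rw [det_updateRow_lapMatrix] at h
  exact_mod_cast h

theorem four_dvd_spanningTreeCount_of_lapMatrix (r : V) {k : ℤ} (hk : Even k)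
    (h : 2 ≤ eigenvalueMultiplicity (G.lapMatrix ℝ) (k : ℝ)) : 4 ∣ G.spanningTreeCount := by
  rw [← lapMatrix_map_intCast] at h
  obtain ⟨z, hz, hzr, hodd⟩ := exists_odd_mulVec_eq_smul_of_two_le_eigenvalueMultiplicity h r
  obtain ⟨m, rfl⟩ := hk
  refine G.four_dvd_spanningTreeCount_of_mulVec_eq (d := fun _ => m) ?_ hzr hodd
  rw [hz]
  ext v
  simp only [Pi.smul_apply, Pi.mul_apply, smul_eq_mul]
  ring

theorem four_dvd_spanningTreeCount_of_signlessLapMatrix (r : V) {k : ℤ} (hk : Even k)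
    (h : 2 ≤ eigenvalueMultiplicity (G.signlessLapMatrix ℝ) (k : ℝ)) :
    4 ∣ G.spanningTreeCount := by
  rw [← signlessLapMatrix_map_intCast] at h
  obtain ⟨z, hz, hzr, hodd⟩ := exists_odd_mulVec_eq_smul_of_two_le_eigenvalueMultiplicity h r
  obtain ⟨m, rfl⟩ := hk
  refine G.four_dvd_spanningTreeCount_of_mulVec_eq (d := fun v => G.degree v - m) ?_ hzr hodd
  rw [signlessLapMatrix_mulVec_eq] at hz
  ext v
  have hv := congrFun hz v
  simp only [Pi.smul_apply, Pi.mul_apply, Pi.sub_apply, smul_eq_mul, degMatrix_mulVec_apply] at hv ⊢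
  linarith

theorem spanningTreeCount_eq_zero_of_not_connected {V : Type*} {G : SimpleGraph V}
    (h : ¬ G.Connected) : G.spanningTreeCount = 0 := by
  have : {T : SimpleGraph V | T ≤ G ∧ T.IsTree} = ∅ :=
    Set.eq_empty_of_forall_notMem fun T hT => h (hT.2.connected.mono hT.1)
  rw [spanningTreeCount, this, Set.ncard_empty]

/-- The columns of the incidence matrix belonging to the edges of `G`. -/
def edgeIncMatrix {V : Type*} [DecidableEq V] (G : SimpleGraph V) [DecidableRel G.Adj] :
    Matrix V G.edgeSet ℝ :=
  (G.incMatrix ℝ).submatrix id Subtype.val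

theorem edgeIncMatrix_apply {V : Type*} [DecidableEq V] (G : SimpleGraph V) [DecidableRel G.Adj]
    (v : V) (e : G.edgeSet) :
    G.edgeIncMatrix v e = if v ∈ (e : Sym2 V) then 1 else 0 := by
  simp only [edgeIncMatrix, Matrix.submatrix_apply, id, incMatrix_apply']
  exact if_congr (by simp [incidenceSet, e.2]) rfl rfl

open Matrix in
theorem edgeIncMatrix_mul_transpose :
    G.edgeIncMatrix * G.edgeIncMatrixᵀ = G.signlessLapMatrix ℝ := by
  ext u v
  simp only [signlessLapMatrix, mul_apply, transpose_apply, edgeIncMatrix, submatrix_apply, id]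
  rw [← Finset.sum_subset (Finset.subset_univ G.edgeFinset) fun e _ he => ?_,
    Finset.sum_subtype G.edgeFinset fun e => mem_edgeFinset]
  rw [G.incMatrix_of_notMem_incidenceSet fun h => he (mem_edgeFinset.2 h.1), zero_mul]

open Matrix in
theorem transpose_mul_edgeIncMatrix [DecidableRel G.lineGraph.Adj] :
    G.edgeIncMatrixᵀ * G.edgeIncMatrix = G.lineGraph.adjMatrix ℝ + (2 : ℝ) • 1 := by
  ext e e'
  simp only [mul_apply, transpose_apply, edgeIncMatrix_apply, Matrix.add_apply,
    Matrix.smul_apply, one_apply,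
    adjMatrix_apply, smul_eq_mul, ← ite_and, mul_ite, mul_one, mul_zero]
  by_cases hee : e = e'
  · subst hee
    have h := G.incMatrix_transpose_mul_diag (R := ℝ) (e := (e : Sym2 V))
    simpa [mul_apply, incMatrix_apply', incidenceSet, e.2, ← ite_and] using h
  · rw [if_neg hee, add_zero]
    by_cases hadj : G.lineGraph.Adj e e'
    · -- Distinct edges have at most one common endpoint.
      obtain ⟨-, v, hv, hv'⟩ := hadj
      rw [if_pos ⟨hee, v, hv, hv'⟩, Finset.sum_eq_single v, if_pos ⟨hv', hv⟩]
      · rintro u - huv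
        refine if_neg fun hu => hee (Subtype.ext ?_)
        rw [(Sym2.mem_and_mem_iff huv).1 ⟨hu.2, hv⟩, (Sym2.mem_and_mem_iff huv).1 ⟨hu.1, hv'⟩]
      · exact fun h => absurd (Finset.mem_univ v) h
    · rw [if_neg hadj]
      exact Finset.sum_eq_zero fun v _ => if_neg fun hv => hadj ⟨hee, v, hv.2, hv.1⟩

open Matrix in
theorem eigenvalueMultiplicity_lineGraph_le [DecidableRel G.lineGraph.Adj] {μ : ℝ} (hμ : μ ≠ -2) :
    eigenvalueMultiplicity (G.lineGraph.adjMatrix ℝ) μ ≤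
      eigenvalueMultiplicity (G.signlessLapMatrix ℝ) (μ + 2) := by
  have hX : ∀ y ∈ Module.End.eigenspace (toLin' (G.lineGraph.adjMatrix ℝ)) μ,
      G.edgeIncMatrixᵀ *ᵥ (G.edgeIncMatrix *ᵥ y) = (μ + 2) • y := by
    intro y hy
    rw [Module.End.mem_eigenspace_iff, toLin'_apply] at hy
    rw [mulVec_mulVec, transpose_mul_edgeIncMatrix, add_mulVec, hy, smul_mulVec, one_mulVec,
      add_smul]
  have hmem : ∀ y ∈ Module.End.eigenspace (toLin' (G.lineGraph.adjMatrix ℝ)) μ,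
      toLin' G.edgeIncMatrix y ∈
        Module.End.eigenspace (toLin' (G.signlessLapMatrix ℝ)) (μ + 2) := by
    intro y hy
    rw [Module.End.mem_eigenspace_iff, toLin'_apply, toLin'_apply, ← edgeIncMatrix_mul_transpose,
      ← mulVec_mulVec, hX y hy, mulVec_smul]
  refine LinearMap.finrank_le_finrank_of_injective
    (f := (toLin' G.edgeIncMatrix).restrict hmem) ?_
  rw [← LinearMap.ker_eq_bot, LinearMap.ker_eq_bot']
  rintro ⟨y, hy⟩ h0
  have h1 : G.edgeIncMatrix *ᵥ y = 0 := congrArg Subtype.val h0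
  have h2 := hX y hy
  rw [h1, mulVec_zero] at h2
  exact Subtype.ext ((smul_eq_zero.1 h2.symm).resolve_left fun h => hμ (by linarith))

end SimpleGraph

theorem mainTheorem2 {V : Type*} [Fintype V] [DecidableEq V] (G : SimpleGraph V)
    [DecidableRel G.Adj] [DecidableRel G.lineGraph.Adj] :
    (G.Connected →
      (∃ k : ℤ, Even k ∧
        (2 ≤ eigenvalueMultiplicity (G.lapMatrix ℝ) (k : ℝ) ∨
          2 ≤ eigenvalueMultiplicity (G.signlessLapMatrix ℝ) (k : ℝ))) →
      4 ∣ G.spanningTreeCount) ∧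
    ((∃ k : ℤ, Even k ∧ k ≠ -2 ∧
        2 ≤ eigenvalueMultiplicity (G.lineGraph.adjMatrix ℝ) (k : ℝ)) →
      4 ∣ G.spanningTreeCount) := by
  constructor
  · rintro hG ⟨k, hk, h | h⟩
    · exact G.four_dvd_spanningTreeCount_of_lapMatrix hG.nonempty.some hk h
    · exact G.four_dvd_spanningTreeCount_of_signlessLapMatrix hG.nonempty.some hk h
  · rintro ⟨k, hk, hk2, h⟩
    by_cases hG : G.Connected
    · have h1 := h.trans (G.eigenvalueMultiplicity_lineGraph_le (by exact_mod_cast hk2))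
      refine G.four_dvd_spanningTreeCount_of_signlessLapMatrix hG.nonempty.some
        (hk.add even_two) (k := k + 2) ?_
      exact_mod_cast h1
    · rw [SimpleGraph.spanningTreeCount_eq_zero_of_not_connected hG]
      exact dvd_zero 4
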